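/- Let $H$ be a complex Hilbert space with orthonormal basis $(e_i)_{i\in I}$. For a bounded operator $A$ on $H$ put $|A|=(A^*A)^{1/2}$; $A$ is Hilbert–Schmidt if $\sum_i\|Ae_i\|^2<\infty$, it is trace class if $\sum_i\langle |A|e_i,e_i\rangle<\infty$, and then $\operatorname{tr}(A)=\sum_i\langle Ae_i,e_i\rangle$. Let $f(z)=\sum_{j\ge 0}p_jz^j$ and $g(z)=\sum_{j\ge 0}q_jz^j$ be power series with nonnegative coefficients that converge on the open disk $\{|z|<R\}$, where $0<R\le\infty$; if $H$ is infinite-dimensional, assume in addition $p_0=q_0=0$. For a bounded operator $A$ write $f(A)=\sum_j p_jA^j$ and $g(A)=\sum_j q_jA^j$, with convergence in the operator norm. Let $T,V$ be normal Hilbert–Schmidt operators on $H$ with $TV=VT$ and $\operatorname{tr}(|T|^2),\operatorname{tr}(|V|^2)<R$. Then the series $h(|T|^2)$, $h(|V|^2)$, $h(T^*V)$ with $h\in\{f,g\}$ converge in operator norm to trace class operators, the traces of $h(|T|^2)$ and $h(|V|^2)$ are nonnegative real numbers, and $$[\operatorname{tr}(f(|T|^2)+g(|T|^2))]^{1/2}[\operatorname{tr}(f(|V|^2)+g(|V|^2))]^{1/2}-|\operatorname{tr}(f(T^*V)+g(T^*V))|$$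 $$\ge [\operatorname{tr} f(|T|^2)]^{1/2}[\operatorname{tr} f(|V|^2)]^{1/2}-|\operatorname{tr} f(T^*V)|+[\operatorname{tr} g(|T|^2)]^{1/2}[\operatorname{tr} g(|V|^2)]^{1/2}-|\operatorname{tr} g(T^*V)|\ \ge 0.$$ Moreover, if $p_j\ge q_j$ for all $j\ge 0$, then $$[\operatorname{tr} f(|T|^2)]^{1/2}[\operatorname{tr} f(|V|^2)]^{1/2}-|\operatorname{tr} f(T^*V)|\ \ge\ [\operatorname{tr} g(|T|^2)]^{1/2}[\operatorname{tr} g(|V|^2)]^{1/2}-|\operatorname{tr} g(T^*V)|\ \ge 0.$$ -/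

import Mathlib

namespace TraceIneq

variable {H : Type*} [NormedAddCommGroup H] [InnerProductSpace ℂ H] [CompleteSpace H]
variable {ι : Type*}

/-- `A` is a Hilbert–Schmidt operator: `∑ i, ‖A eᵢ‖² < ∞`, where `(eᵢ)` is an orthonormal basis. -/
def IsHilbertSchmidt (e : HilbertBasis ι ℂ H) (A : H →L[ℂ] H) : Prop :=
  Summable fun i => ‖A (e i)‖ ^ 2

/-- `A` is trace class: `∑ i, ⟨|A| eᵢ, eᵢ⟩ < ∞`, where `(eᵢ)` is an orthonormal basis and
`|A| = (A* A)^{1/2}` is the modulus of `A` (the terms are nonnegative reals). -/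
def IsTraceClass (e : HilbertBasis ι ℂ H) (A : H →L[ℂ] H) : Prop :=
  Summable fun i => (inner ℂ (e i) (CFC.abs A (e i))).re

/-- The trace `tr A = ∑ i, ⟨A eᵢ, eᵢ⟩`, where `(eᵢ)` is an orthonormal basis. (Mathlib's inner
product is linear in the second variable.) -/
noncomputable def tr (e : HilbertBasis ι ℂ H) (A : H →L[ℂ] H) : ℂ :=
  ∑' i, inner ℂ (e i) (A (e i))

/-- The `j`-th term `p_j A^j` of the power series `f(z) = ∑ p_j z^j` evaluated at an operator. -/
noncomputable def seriesTerm (p : ℕ → ℝ) (A : H →L[ℂ] H) (j : ℕ) : H →L[ℂ] H :=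
  (p j : ℂ) • A ^ j

/-- `f(A) = ∑ p_j A^j` for the power series `f(z) = ∑ p_j z^j`, the sum being taken in the
operator norm. -/
noncomputable def applySeries (p : ℕ → ℝ) (A : H →L[ℂ] H) : H →L[ℂ] H :=
  ∑' j, seriesTerm p A j

end TraceIneq

namespace TraceIneq

open ContinuousLinearMap ENNReal

variable {H : Type*} [NormedAddCommGroup H] [InnerProductSpace ℂ H]
variable {ι : Type*}

/-! ### Hilbert–Schmidt norms and powers. -/

section HilbertSchmidt

/-! By Fuglede, `T*` commutes with `V`, so `(T*V)^j = (T^j)* V^j`, and normality gives the same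
splitting for `|T|²`, `|V|²`. Each trace is thus a semi-inner product `∑ p_j ⟨A^j, B^j⟩` of
sequences of powers (`hasSum_tr_applySeries`), and the defect `√·√· - |·|` is nonnegative by
Cauchy–Schwarz. It is superadditive in the weight by Cauchy–Schwarz in `ℝ²` and the triangle
inequality (`defect_add_le`); monotonicity is superadditivity for `p = q + (p - q)`. Convergence
rests on `‖A^j‖₂² ≤ ‖A‖₂^(2j)` for `j ≥ 1`. Trace class membership comes from bounding `∑ Re ⟨W eᵢ,
M eᵢ⟩` uniformly over contractions `W`. -/

/-- The squared Hilbert–Schmidt norm, with values in `[0, ∞]`. -/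
noncomputable def hsSq (e : HilbertBasis ι ℂ H) (A : H →L[ℂ] H) : ℝ≥0∞ :=
  ∑' i, ‖A (e i)‖ₑ ^ 2

lemma hasSum_norm_inner_sq (e : HilbertBasis ι ℂ H) (x : H) :
    HasSum (fun i => ‖inner ℂ (e i) x‖ ^ 2) (‖x‖ ^ 2) := by
  have h := Complex.hasSum_re (e.hasSum_inner_mul_inner x x)
  convert h using 1
  · funext i
    rw [← inner_conj_symm x (e i), mul_comm, Complex.mul_conj, Complex.ofReal_re,
      Complex.normSq_eq_norm_sq]
  · rw [← inner_self_eq_norm_sq (𝕜 := ℂ) x]; rfl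

lemma tsum_enorm_inner_sq (e : HilbertBasis ι ℂ H) (x : H) :
    ∑' i, ‖inner ℂ (e i) x‖ₑ ^ 2 = ‖x‖ₑ ^ 2 := by
  have h := hasSum_norm_inner_sq e x
  have h2 := ENNReal.ofReal_tsum_of_nonneg (fun i => by positivity) h.summable
  rw [h.tsum_eq] at h2
  simpa [ENNReal.ofReal_pow, ofReal_norm] using h2.symm

/-- By Parseval both sides are the sum of all squared matrix entries; in `[0, ∞]` the order of
summation is free. -/
lemma hsSq_adjoint [CompleteSpace H] (e : HilbertBasis ι ℂ H) (A : H →L[ℂ] H) :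
    hsSq e (adjoint A) = hsSq e A := by
  simp only [hsSq]
  simp_rw [← tsum_enorm_inner_sq e]
  rw [ENNReal.tsum_comm]
  refine tsum_congr fun i => tsum_congr fun j => ?_
  rw [adjoint_inner_right, ← inner_conj_symm, enorm_eq_nnnorm, enorm_eq_nnnorm,
    starRingEnd_apply, nnnorm_star]

lemma hsSq_mul_le_left (e : HilbertBasis ι ℂ H) (A B : H →L[ℂ] H) :
    hsSq e (A * B) ≤ ‖A‖ₑ ^ 2 * hsSq e B := by
  simp only [hsSq, ← ENNReal.tsum_mul_left]
  refine ENNReal.tsum_le_tsum fun i => ?_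
  rw [← mul_pow]
  gcongr
  exact A.le_opENorm _

lemma hsSq_mul_le_right [CompleteSpace H] (e : HilbertBasis ι ℂ H) (A B : H →L[ℂ] H) :
    hsSq e (A * B) ≤ ‖B‖ₑ ^ 2 * hsSq e A := by
  rw [← hsSq_adjoint, ← hsSq_adjoint e A]
  have : adjoint (A * B) = adjoint B * adjoint A := star_mul A B
  rw [this]
  refine (hsSq_mul_le_left e _ _).trans_eq ?_
  rw [← star_eq_adjoint, enorm_eq_nnnorm, enorm_eq_nnnorm, nnnorm_star]

lemma enorm_sq_le_hsSq [CompleteSpace H] (e : HilbertBasis ι ℂ H) (A : H →L[ℂ] H) (x : H) :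
    ‖A x‖ₑ ^ 2 ≤ hsSq e A * ‖x‖ₑ ^ 2 := by
  rw [← hsSq_adjoint, ← tsum_enorm_inner_sq e, hsSq, ← ENNReal.tsum_mul_right]
  refine ENNReal.tsum_le_tsum fun i => ?_
  rw [← adjoint_inner_left, ← mul_pow]
  gcongr
  simp only [enorm_eq_nnnorm]
  exact_mod_cast nnnorm_inner_le_nnnorm (𝕜 := ℂ) _ x

lemma hsSq_eq_ofReal {e : HilbertBasis ι ℂ H} {A : H →L[ℂ] H} (hA : IsHilbertSchmidt e A) :
    hsSq e A = ENNReal.ofReal (∑' i, ‖A (e i)‖ ^ 2) := by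
  rw [ENNReal.ofReal_tsum_of_nonneg (fun i => by positivity) hA]
  simp [hsSq, ENNReal.ofReal_pow, ofReal_norm]

lemma norm_sq_le_tsum [CompleteSpace H] {e : HilbertBasis ι ℂ H} {A : H →L[ℂ] H} (hA : IsHilbertSchmidt e A) :
    ‖A‖ ^ 2 ≤ ∑' i, ‖A (e i)‖ ^ 2 := by
  set s := ∑' i, ‖A (e i)‖ ^ 2 with hs
  have hs0 : 0 ≤ s := tsum_nonneg fun i => by positivity
  have : ‖A‖ ≤ √s := by
    refine A.opNorm_le_bound (Real.sqrt_nonneg _) fun x => ?_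
    have h := enorm_sq_le_hsSq e A x
    rw [hsSq_eq_ofReal hA, ← hs, ← ofReal_norm, ← ofReal_norm,
      ← ENNReal.ofReal_pow (norm_nonneg _), ← ENNReal.ofReal_pow (norm_nonneg _),
      ← ENNReal.ofReal_mul hs0, ENNReal.ofReal_le_ofReal_iff (by positivity)] at h
    refine abs_le_of_sq_le_sq' ?_ (by positivity) |>.2
    rwa [mul_pow, Real.sq_sqrt hs0]
  calc ‖A‖ ^ 2 ≤ √s ^ 2 := by gcongr
    _ = s := Real.sq_sqrt hs0

/-- One factor `A` acts on the basis vector; the other `j` cost the operator norm, at most the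
Hilbert–Schmidt norm. Hence the shift: the identity is not Hilbert–Schmidt in infinite dimension. -/
lemma norm_pow_apply_sq_le [CompleteSpace H] {e : HilbertBasis ι ℂ H} {A : H →L[ℂ] H}
    (hA : IsHilbertSchmidt e A) (j : ℕ) (i : ι) :
    ‖(A ^ (j + 1)) (e i)‖ ^ 2 ≤ (∑' i, ‖A (e i)‖ ^ 2) ^ j * ‖A (e i)‖ ^ 2 := by
  induction j with
  | zero => simp
  | succ j ih =>
    rw [pow_succ' A (j + 1), mul_apply_eq_comp]
    calc ‖A ((A ^ (j + 1)) (e i))‖ ^ 2 ≤ (‖A‖ * ‖(A ^ (j + 1)) (e i)‖) ^ 2 := by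
          gcongr; exact A.le_opNorm _
      _ = ‖A‖ ^ 2 * ‖(A ^ (j + 1)) (e i)‖ ^ 2 := mul_pow _ _ _
      _ ≤ (∑' i, ‖A (e i)‖ ^ 2) * ((∑' i, ‖A (e i)‖ ^ 2) ^ j * ‖A (e i)‖ ^ 2) := by
          gcongr
          exact norm_sq_le_tsum hA
      _ = _ := by ring

end HilbertSchmidt

/-! ### Weighted Cauchy–Schwarz defects. -/

section Energy

/-- The family whose sum is `∑ j, p j * ‖A ^ j‖₂²`. -/
noncomputable def energyTerm (e : HilbertBasis ι ℂ H) (p : ℕ → ℝ) (A : H →L[ℂ] H)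
    (x : ι × ℕ) : ℝ :=
  p x.2 * ‖(A ^ x.2) (e x.1)‖ ^ 2

/-- The weighted Hilbert–Schmidt norm `∑ j, p j * ‖A ^ j‖₂²` of the sequence of powers of `A`. -/
noncomputable def energy (e : HilbertBasis ι ℂ H) (p : ℕ → ℝ) (A : H →L[ℂ] H) : ℝ :=
  ∑' x, energyTerm e p A x

/-- The family whose sum is `∑ j, p j * ⟨A ^ j, B ^ j⟩₂`. -/
noncomputable def pairingTerm (e : HilbertBasis ι ℂ H) (p : ℕ → ℝ) (A B : H →L[ℂ] H)
    (x : ι × ℕ) : ℂ :=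
  (p x.2 : ℂ) * inner ℂ ((A ^ x.2) (e x.1)) ((B ^ x.2) (e x.1))

/-- The weighted Hilbert–Schmidt pairing `∑ j, p j * ⟨A ^ j, B ^ j⟩₂` of the sequences of powers. -/
noncomputable def pairing (e : HilbertBasis ι ℂ H) (p : ℕ → ℝ) (A B : H →L[ℂ] H) : ℂ :=
  ∑' x, pairingTerm e p A B x

variable {e : HilbertBasis ι ℂ H} {p q : ℕ → ℝ} {A B : H →L[ℂ] H}

lemma energyTerm_nonneg (hp : ∀ j, 0 ≤ p j) (x : ι × ℕ) : 0 ≤ energyTerm e p A x :=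
  mul_nonneg (hp _) (by positivity)

lemma energy_nonneg (hp : ∀ j, 0 ≤ p j) : 0 ≤ energy e p A :=
  tsum_nonneg (energyTerm_nonneg hp)

lemma summable_energyTerm_slice [CompleteSpace H] (hp : ∀ j, 0 ≤ p j)
    (hA : IsHilbertSchmidt e A) (j : ℕ) :
    Summable (fun i => energyTerm e p A (i, j + 1)) ∧
      ∑' i, energyTerm e p A (i, j + 1) ≤ p (j + 1) * (∑' i, ‖A (e i)‖ ^ 2) ^ (j + 1) := by
  have hle (i : ι) : energyTerm e p A (i, j + 1)
      ≤ p (j + 1) * ((∑' i, ‖A (e i)‖ ^ 2) ^ j * ‖A (e i)‖ ^ 2) :=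
    mul_le_mul_of_nonneg_left (norm_pow_apply_sq_le hA j i) (hp _)
  have hsum : Summable fun i => p (j + 1) * ((∑' i, ‖A (e i)‖ ^ 2) ^ j * ‖A (e i)‖ ^ 2) :=
    Summable.mul_left _ (Summable.mul_left _ hA)
  have h := Summable.of_nonneg_of_le (fun i => energyTerm_nonneg hp _) hle hsum
  refine ⟨h, (h.tsum_le_tsum hle hsum).trans_eq ?_⟩
  rw [tsum_mul_left, tsum_mul_left, pow_succ]

lemma summable_energyTerm [CompleteSpace H] (hp : ∀ j, 0 ≤ p j) (hA : IsHilbertSchmidt e A)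
    (hs : Summable fun j => p j * (∑' i, ‖A (e i)‖ ^ 2) ^ j) (h0 : Finite ι ∨ p 0 = 0) :
    Summable (energyTerm e p A) := by
  have key (j : ℕ) : Summable fun i => energyTerm e p A (i, j) := by
    rcases j with _ | j
    · rcases h0 with h | h
      · exact Summable.of_finite
      · simp [energyTerm, h]
    · exact (summable_energyTerm_slice hp hA j).1
  -- Fixing the power and summing over the basis first gives slices dominated by the scalar power
  -- series.
  refine (Equiv.prodComm ℕ ι).summable_iff.1 ((summable_prod_of_nonneg
    fun x => energyTerm_nonneg hp _).2 ⟨key, (summable_nat_add_iff 1).1 ?_⟩)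
  exact Summable.of_nonneg_of_le (fun j => tsum_nonneg fun i => energyTerm_nonneg hp _)
    (fun j => (summable_energyTerm_slice hp hA j).2) ((summable_nat_add_iff 1).2 hs)

lemma norm_pairingTerm_le (hp : ∀ j, 0 ≤ p j) (x : ι × ℕ) :
    ‖pairingTerm e p A B x‖ ≤ √(energyTerm e p A x) * √(energyTerm e p B x) := by
  rw [← Real.sqrt_mul (energyTerm_nonneg hp x)]
  refine Real.le_sqrt_of_sq_le ?_
  rw [pairingTerm, norm_mul, Complex.norm_of_nonneg (hp _), energyTerm, energyTerm]
  calc (p x.2 * ‖inner ℂ ((A ^ x.2) (e x.1)) ((B ^ x.2) (e x.1))‖) ^ 2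
      ≤ (p x.2 * (‖(A ^ x.2) (e x.1)‖ * ‖(B ^ x.2) (e x.1)‖)) ^ 2 := by
        have := hp x.2
        gcongr
        exact norm_inner_le_norm _ _
    _ = _ := by ring

lemma summable_sqrt_energyTerm_mul (hp : ∀ j, 0 ≤ p j) (hA : Summable (energyTerm e p A))
    (hB : Summable (energyTerm e p B)) :
    Summable (fun x => √(energyTerm e p A x) * √(energyTerm e p B x)) ∧
      ∑' x, √(energyTerm e p A x) * √(energyTerm e p B x) ≤ √(energy e p A) * √(energy e p B) := by
  have h := Real.summable_and_inner_le_Lp_mul_Lq_tsum_of_nonneg Real.HolderConjugate.two_two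
    (f := fun x => √(energyTerm e p A x)) (g := fun x => √(energyTerm e p B x))
    (fun x => Real.sqrt_nonneg _) (fun x => Real.sqrt_nonneg _)
  simp only [Real.rpow_two, Real.sq_sqrt (energyTerm_nonneg hp _), ← Real.sqrt_eq_rpow] at h
  exact h hA hB

lemma summable_norm_pairingTerm (hp : ∀ j, 0 ≤ p j) (hA : Summable (energyTerm e p A))
    (hB : Summable (energyTerm e p B)) : Summable fun x => ‖pairingTerm e p A B x‖ :=
  Summable.of_nonneg_of_le (fun _ => norm_nonneg _) (norm_pairingTerm_le hp)
    (summable_sqrt_energyTerm_mul hp hA hB).1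

/-- The Cauchy–Schwarz inequality for the weighted pairing. -/
lemma norm_pairing_le (hp : ∀ j, 0 ≤ p j) (hA : Summable (energyTerm e p A))
    (hB : Summable (energyTerm e p B)) :
    ‖pairing e p A B‖ ≤ √(energy e p A) * √(energy e p B) := by
  have h := summable_sqrt_energyTerm_mul hp hA hB
  exact ((norm_tsum_le_tsum_norm (summable_norm_pairingTerm hp hA hB)).trans
    ((summable_norm_pairingTerm hp hA hB).tsum_le_tsum (norm_pairingTerm_le hp) h.1)).trans h.2

lemma pairing_self : pairing e p A A = (energy e p A : ℂ) := by
  rw [pairing, energy, Complex.ofReal_tsum]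
  refine tsum_congr fun x => ?_
  rw [pairingTerm, energyTerm, inner_self_eq_norm_sq_to_K]
  simp

lemma energy_add (hp : Summable (energyTerm e p A)) (hq : Summable (energyTerm e q A)) :
    energy e (p + q) A = energy e p A + energy e q A := by
  rw [energy, energy, energy, ← hp.tsum_add hq]
  exact tsum_congr fun x => add_mul _ _ _

lemma pairing_add (hp : Summable (pairingTerm e p A B)) (hq : Summable (pairingTerm e q A B)) :
    pairing e (p + q) A B = pairing e p A B + pairing e q A B := by
  rw [pairing, pairing, pairing, ← hp.tsum_add hq]
  refine tsum_congr fun x => ?_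
  simp [pairingTerm, add_mul]

/-- Cauchy–Schwarz in `ℝ²` for `(√a, √c)` and `(√b, √d)`. -/
lemma sqrt_mul_sqrt_add_le {a b c d : ℝ} (ha : 0 ≤ a) (hb : 0 ≤ b) (hc : 0 ≤ c) (hd : 0 ≤ d) :
    √a * √b + √c * √d ≤ √(a + c) * √(b + d) := by
  rw [← Real.sqrt_mul (by positivity : 0 ≤ a + c)]
  refine Real.le_sqrt_of_sq_le ?_
  nlinarith [sq_nonneg (√a * √d - √c * √b), Real.sq_sqrt ha, Real.sq_sqrt hb, Real.sq_sqrt hc,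
    Real.sq_sqrt hd, mul_pow (√a) (√d) 2, mul_pow (√c) (√b) 2, mul_pow (√a) (√b) 2,
    mul_pow (√c) (√d) 2]

/-- Superadditivity of the Cauchy–Schwarz defect in the weight. -/
lemma defect_add_le (hp : ∀ j, 0 ≤ p j) (hq : ∀ j, 0 ≤ q j) :
    (√(energy e p A) * √(energy e p B) - ‖pairing e p A B‖)
        + (√(energy e q A) * √(energy e q B) - ‖pairing e q A B‖)
      ≤ √(energy e p A + energy e q A) * √(energy e p B + energy e q B)
        - ‖pairing e p A B + pairing e q A B‖ := by
  have h1 := sqrt_mul_sqrt_add_le (energy_nonneg (e := e) (A := A) hp)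
    (energy_nonneg (e := e) (A := B) hp) (energy_nonneg (e := e) (A := A) hq)
    (energy_nonneg (e := e) (A := B) hq)
  have h2 := norm_add_le (pairing e p A B) (pairing e q A B)
  linarith

/-- Monotonicity of the Cauchy–Schwarz defect in the weight. -/
lemma defect_mono (hq : ∀ j, 0 ≤ q j) (hqp : ∀ j, q j ≤ p j)
    (hpA : Summable (energyTerm e p A)) (hpB : Summable (energyTerm e p B))
    (hqA : Summable (energyTerm e q A)) (hqB : Summable (energyTerm e q B)) :
    √(energy e q A) * √(energy e q B) - ‖pairing e q A B‖
      ≤ √(energy e p A) * √(energy e p B) - ‖pairing e p A B‖ := by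
  obtain ⟨r, rfl⟩ : ∃ r, p = q + r := ⟨p - q, by simp⟩
  have hr : ∀ j, 0 ≤ r j := fun j => by simpa using hqp j
  have aux : ∀ {C : H →L[ℂ] H}, Summable (energyTerm e (q + r) C) → Summable (energyTerm e q C) →
      Summable (energyTerm e r C) := fun h1 h2 => (h1.sub h2).congr fun x => by
    simp [energyTerm, add_mul]
  have hrA := aux hpA hqA
  have hrB := aux hpB hqB
  rw [energy_add hqA hrA, energy_add hqB hrB,
    pairing_add (summable_norm_pairingTerm hq hqA hqB).of_norm
      (summable_norm_pairingTerm hr hrA hrB).of_norm]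
  have h1 := defect_add_le (e := e) (A := A) (B := B) hq hr
  have h2 := norm_pairing_le hr hrA hrB
  linarith

end Energy

end TraceIneq

namespace TraceIneq

open ContinuousLinearMap ENNReal

variable {H : Type*} [NormedAddCommGroup H] [InnerProductSpace ℂ H]
variable {ι : Type*} {e : HilbertBasis ι ℂ H} {p q : ℕ → ℝ} {A B M : H →L[ℂ] H}

/-! ### A trace class criterion. -/

section TraceClass

variable [CompleteSpace H]

/-- An approximate polar decomposition: `|M|` is a norm limit of operators `W* M` with
contractions `W`. -/
lemma exists_contraction_mul_near_abs (M : H →L[ℂ] H) {ε : ℝ} (hε : 0 < ε) :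
    ∃ W : H →L[ℂ] H, ‖W‖ ≤ 1 ∧ ‖CFC.abs M - adjoint W * M‖ ≤ ε := by
  set P := CFC.abs M with hP
  have hP0 : 0 ≤ P := CFC.abs_nonneg M
  have hPsa : IsSelfAdjoint P := .of_nonneg hP0
  have hne (x : ℝ) : |x| + ε ≠ 0 := by positivity
  have hg : Continuous fun x : ℝ => (|x| + ε)⁻¹ :=
    (continuous_abs.add continuous_const).inv₀ hne
  have hg2 : Continuous fun x : ℝ => (|x| + ε)⁻¹ * x := hg.mul continuous_id'
  have hg3 : Continuous fun x : ℝ => (|x| + ε)⁻¹ * x * x := hg2.mul continuous_id'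
  -- A regularised inverse of `|M|`, making `M * G` a substitute for the polar isometry.
  set G := cfc (fun x : ℝ => (|x| + ε)⁻¹) P with hG
  have hGsa : star G = G := (cfc_predicate (R := ℝ) _ P : IsSelfAdjoint G)
  have hPP : star M * M = P * P := (CFC.abs_mul_abs M).symm
  have hGP : G * P = cfc (fun x : ℝ => (|x| + ε)⁻¹ * x) P := by
    rw [cfc_mul _ _ P hg.continuousOn (continuousOn_id' _), cfc_id' ℝ P]
  have hGPn : ‖G * P‖ ≤ 1 := by
    rw [hGP]
    refine norm_cfc_le zero_le_one fun x _ => ?_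
    rw [norm_mul, norm_inv, Real.norm_eq_abs, Real.norm_eq_abs, abs_of_pos (by positivity),
      inv_mul_le_one₀ (by positivity)]
    linarith
  refine ⟨M * G, ?_, ?_⟩
  · have h : star (M * G) * (M * G) = (G * P) * star (G * P) := by
      rw [star_mul, star_mul, hGsa, hPsa.star_eq, mul_assoc, ← mul_assoc (star M), hPP]
      simp only [mul_assoc]
    have h1 : ‖M * G‖ * ‖M * G‖ = ‖G * P‖ * ‖G * P‖ := by
      rw [← CStarRing.norm_star_mul_self, h, CStarRing.norm_self_mul_star]
    rwa [(mul_self_inj (norm_nonneg _) (norm_nonneg _)).1 h1]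
  · have h : P - adjoint (M * G) * M = cfc (fun x : ℝ => x - (|x| + ε)⁻¹ * x * x) P := by
      rw [cfc_sub _ _ P (continuousOn_id' _) hg3.continuousOn,
        cfc_mul _ _ P hg2.continuousOn (continuousOn_id' _), ← hGP, cfc_id' ℝ P,
        ← star_eq_adjoint, star_mul, hGsa, mul_assoc, hPP, mul_assoc]
    rw [h]
    refine norm_cfc_le hε.le fun x hx => ?_
    have hx0 : 0 ≤ x := spectrum_nonneg_of_nonneg hP0 hx
    -- On the spectrum the error is `ε` times a factor in `[0, 1]`.
    have : x - (|x| + ε)⁻¹ * x * x = ε * (x / (x + ε)) := by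
      rw [abs_of_nonneg hx0]
      have : x + ε ≠ 0 := by positivity
      field_simp
      ring
    rw [this, Real.norm_of_nonneg (by positivity)]
    exact mul_le_of_le_one_right hε.le (div_le_one_of_le₀ (by linarith) (by positivity))

/-- An operator is trace class if its pairings with contractions are bounded. -/
lemma isTraceClass_of_forall_contraction {C : ℝ}
    (h : ∀ W : H →L[ℂ] H, ‖W‖ ≤ 1 → ∀ s : Finset ι,
      ∑ i ∈ s, (inner ℂ (W (e i)) (M (e i))).re ≤ C) : IsTraceClass e M := by
  have hpos (i : ι) : 0 ≤ (inner ℂ (e i) (CFC.abs M (e i))).re := by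
    have := (nonneg_iff_isPositive _).1 (CFC.abs_nonneg M)
    exact this.re_inner_nonneg_right (e i)
  refine summable_of_sum_le hpos (c := C) fun s => ?_
  refine le_of_forall_pos_le_add fun δ hδ => ?_
  -- The errors over `s` then total at most `δ`; `+ 1` covers empty `s`.
  set ε := δ / (s.card + 1) with hε
  have hε0 : 0 < ε := by positivity
  obtain ⟨W, hW, hWM⟩ := exists_contraction_mul_near_abs M hε0
  have hi (i : ι) : (inner ℂ (e i) (CFC.abs M (e i))).re
      ≤ (inner ℂ (W (e i)) (M (e i))).re + ε := by
    have h1 : inner ℂ (e i) (CFC.abs M (e i))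
        = inner ℂ (W (e i)) (M (e i)) + inner ℂ (e i) ((CFC.abs M - adjoint W * M) (e i)) := by
      simp [adjoint_inner_right]
    have h2 : ‖inner ℂ (e i) ((CFC.abs M - adjoint W * M) (e i))‖ ≤ ε := by
      refine (norm_inner_le_norm _ _).trans ?_
      have := (CFC.abs M - adjoint W * M).le_opNorm (e i)
      rw [e.orthonormal.1 i] at this ⊢
      linarith
    rw [h1, Complex.add_re]
    linarith [Complex.re_le_norm (inner ℂ (e i) ((CFC.abs M - adjoint W * M) (e i)))]
  calc ∑ i ∈ s, (inner ℂ (e i) (CFC.abs M (e i))).re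
      ≤ ∑ i ∈ s, ((inner ℂ (W (e i)) (M (e i))).re + ε) := Finset.sum_le_sum fun i _ => hi i
    _ = ∑ i ∈ s, (inner ℂ (W (e i)) (M (e i))).re + s.card * ε := by
        rw [Finset.sum_add_distrib, Finset.sum_const, nsmul_eq_mul]
    _ ≤ C + δ := by
        refine add_le_add (h W hW s) ?_
        rw [hε, mul_div_assoc', div_le_iff₀ (by positivity)]
        nlinarith

end TraceClass

/-! ### Power series of `A*B` and their traces. -/

section PowerSeries

lemma ofReal_energyTerm (hp : ∀ j, 0 ≤ p j) (x : ι × ℕ) :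
    ENNReal.ofReal (energyTerm e p A x) = ENNReal.ofReal (p x.2) * ‖(A ^ x.2) (e x.1)‖ₑ ^ 2 := by
  rw [energyTerm, ENNReal.ofReal_mul (hp _), ENNReal.ofReal_pow (norm_nonneg _), ofReal_norm]

lemma finite_of_finiteDimensional (h : FiniteDimensional ℂ H) (e : HilbertBasis ι ℂ H) :
    Finite ι :=
  e.orthonormal.linearIndependent.finite

variable [CompleteSpace H]

/-- For each `j`, `‖A^j W‖₂ ≤ ‖A^j‖₂`; the bound is uniform in `W`. -/
lemma summable_energyTerm_comp_contraction (hp : ∀ j, 0 ≤ p j) (hA : Summable (energyTerm e p A))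
    {W : H →L[ℂ] H} (hW : ‖W‖ ≤ 1) :
    Summable (fun x : ι × ℕ => p x.2 * ‖(A ^ x.2) (W (e x.1))‖ ^ 2) ∧
      ∑' x : ι × ℕ, p x.2 * ‖(A ^ x.2) (W (e x.1))‖ ^ 2 ≤ energy e p A := by
  have h0 (x : ι × ℕ) : 0 ≤ p x.2 * ‖(A ^ x.2) (W (e x.1))‖ ^ 2 :=
    mul_nonneg (hp _) (by positivity)
  have hW' : ‖W‖ₑ ≤ 1 := by
    rw [enorm_eq_nnnorm]; exact_mod_cast hW
  have hle : ∑' x : ι × ℕ, ENNReal.ofReal (p x.2 * ‖(A ^ x.2) (W (e x.1))‖ ^ 2)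
      ≤ ENNReal.ofReal (energy e p A) := by
    rw [energy, ENNReal.ofReal_tsum_of_nonneg (energyTerm_nonneg hp) hA]
    simp_rw [ofReal_energyTerm hp, ENNReal.ofReal_mul (hp _),
      ENNReal.ofReal_pow (norm_nonneg _), ofReal_norm]
    rw [ENNReal.tsum_prod', ENNReal.tsum_prod', ENNReal.tsum_comm,
      ENNReal.tsum_comm (α := ι)]
    refine ENNReal.tsum_le_tsum fun j => ?_
    simp only [ENNReal.tsum_mul_left]
    refine mul_le_mul_right ?_ _
    calc hsSq e (A ^ j * W) ≤ ‖W‖ₑ ^ 2 * hsSq e (A ^ j) := hsSq_mul_le_right e _ _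
      _ ≤ 1 ^ 2 * hsSq e (A ^ j) := by gcongr
      _ = hsSq e (A ^ j) := by simp
  have hs : Summable (fun x : ι × ℕ => p x.2 * ‖(A ^ x.2) (W (e x.1))‖ ^ 2) :=
    (ENNReal.summable_toReal (hle.trans_lt ENNReal.ofReal_lt_top).ne).congr
      fun x => ENNReal.toReal_ofReal (h0 x)
  refine ⟨hs, ?_⟩
  rwa [← ENNReal.ofReal_tsum_of_nonneg h0 hs,
    ENNReal.ofReal_le_ofReal_iff (energy_nonneg hp)] at hle

lemma inner_seriesTerm (hAB : Commute (adjoint A) B) (x y : H) (j : ℕ) :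
    inner ℂ x (seriesTerm p (adjoint A * B) j y)
      = (p j : ℂ) * inner ℂ ((A ^ j) x) ((B ^ j) y) := by
  have h : adjoint A ^ j = adjoint (A ^ j) := (star_pow A j).symm
  rw [seriesTerm, hAB.mul_pow, h, smul_apply, inner_smul_right, mul_apply_eq_comp,
    adjoint_inner_right]

lemma hasSum_inner_applySeries (hAB : Commute (adjoint A) B)
    (hs : Summable (seriesTerm p (adjoint A * B))) (x y : H) :
    HasSum (fun j => (p j : ℂ) * inner ℂ ((A ^ j) x) ((B ^ j) y))
      (inner ℂ x (applySeries p (adjoint A * B) y)) := by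
  have h := hs.hasSum.mapL ((innerSL ℂ x).comp (ContinuousLinearMap.apply ℂ H y))
  simp_rw [← inner_seriesTerm hAB x y]
  exact h

lemma summable_seriesTerm {a b : ℝ} (hp : ∀ j, 0 ≤ p j) (ha : ‖A‖ ^ 2 ≤ a) (hb : ‖B‖ ^ 2 ≤ b)
    (hsa : Summable fun j => p j * a ^ j) (hsb : Summable fun j => p j * b ^ j) :
    Summable (seriesTerm p (adjoint A * B)) := by
  have hAB : ‖adjoint A * B‖ ≤ ‖A‖ * ‖B‖ :=
    (norm_mul_le _ _).trans_eq (by rw [← star_eq_adjoint, norm_star])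
  have ha0 : 0 ≤ a := (sq_nonneg _).trans ha
  have hb0 : 0 ≤ b := (sq_nonneg _).trans hb
  refine Summable.of_norm_bounded (hsa.add hsb) fun j => ?_
  rw [seriesTerm, norm_smul, Complex.norm_of_nonneg (hp j), ← mul_add]
  refine mul_le_mul_of_nonneg_left ?_ (hp j)
  have hpow : ‖(adjoint A * B) ^ j‖ ≤ (‖A‖ * ‖B‖) ^ j := by
    -- On the zero space the identity has norm `0`, so `j = 0` is separate.
    rcases Nat.eq_zero_or_pos j with rfl | hj
    · rw [pow_zero, pow_zero]
      exact norm_id_le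
    · exact (norm_pow_le' _ hj).trans (by gcongr)
  have h1 : (‖A‖ ^ j) ^ 2 ≤ a ^ j := by rw [← pow_mul, mul_comm, pow_mul]; gcongr
  have h2 : (‖B‖ ^ j) ^ 2 ≤ b ^ j := by rw [← pow_mul, mul_comm, pow_mul]; gcongr
  rw [mul_pow] at hpow
  nlinarith [sq_nonneg (‖A‖ ^ j - ‖B‖ ^ j), sq_nonneg (‖A‖ ^ j + ‖B‖ ^ j)]

/-- Absolute summability over `ι × ℕ` permits summing over powers first, then over the basis. -/
lemma hasSum_tr_applySeries (hp : ∀ j, 0 ≤ p j) (hAB : Commute (adjoint A) B)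
    (hs : Summable (seriesTerm p (adjoint A * B)))
    (hA : Summable (energyTerm e p A)) (hB : Summable (energyTerm e p B)) :
    HasSum (fun i => inner ℂ (e i) (applySeries p (adjoint A * B) (e i))) (pairing e p A B) :=
  (summable_norm_pairingTerm hp hA hB).of_norm.hasSum.prod_fiberwise fun i =>
    hasSum_inner_applySeries hAB hs (e i) (e i)

lemma isTraceClass_applySeries (hp : ∀ j, 0 ≤ p j) (hAB : Commute (adjoint A) B)
    (hs : Summable (seriesTerm p (adjoint A * B)))
    (hA : Summable (energyTerm e p A)) (hB : Summable (energyTerm e p B)) :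
    IsTraceClass e (applySeries p (adjoint A * B)) := by
  refine isTraceClass_of_forall_contraction (C := energy e p A + energy e p B) fun W hW s => ?_
  obtain ⟨hWs, hWle⟩ := summable_energyTerm_comp_contraction hp hA hW
  have hsum := hWs.add hB
  have hi (i : ι) : (inner ℂ (W (e i)) (applySeries p (adjoint A * B) (e i))).re
      ≤ ∑' j, (p j * ‖(A ^ j) (W (e i))‖ ^ 2 + energyTerm e p B (i, j)) := by
    refine hasSum_le (fun j => ?_)
      (Complex.hasSum_re (hasSum_inner_applySeries hAB hs (W (e i)) (e i)))
      (hsum.prod_factor i).hasSum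
    -- Termwise, Cauchy–Schwarz and `xy ≤ x² + y²` separate `A` from `B`.
    rw [Complex.re_ofReal_mul, energyTerm, ← mul_add]
    refine mul_le_mul_of_nonneg_left ?_ (hp j)
    have := (Complex.re_le_norm _).trans
      (norm_inner_le_norm (𝕜 := ℂ) ((A ^ j) (W (e i))) ((B ^ j) (e i)))
    nlinarith [sq_nonneg (‖(A ^ j) (W (e i))‖ - ‖(B ^ j) (e i)‖),
      sq_nonneg (‖(A ^ j) (W (e i))‖ + ‖(B ^ j) (e i)‖)]
  calc ∑ i ∈ s, (inner ℂ (W (e i)) (applySeries p (adjoint A * B) (e i))).re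
      ≤ ∑ i ∈ s, ∑' j, (p j * ‖(A ^ j) (W (e i))‖ ^ 2 + energyTerm e p B (i, j)) :=
        Finset.sum_le_sum fun i _ => hi i
    _ ≤ ∑' i, ∑' j, (p j * ‖(A ^ j) (W (e i))‖ ^ 2 + energyTerm e p B (i, j)) :=
        hsum.prod.sum_le_tsum s fun i _ => tsum_nonneg fun j =>
          add_nonneg (mul_nonneg (hp j) (by positivity)) (energyTerm_nonneg hp _)
    _ = ∑' x : ι × ℕ, (p x.2 * ‖(A ^ x.2) (W (e x.1))‖ ^ 2 + energyTerm e p B x) :=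
        hsum.tsum_prod.symm
    _ ≤ energy e p A + energy e p B := by
        rw [hWs.tsum_add hB]
        exact add_le_add hWle le_rfl

lemma tr_abs_sq (e : HilbertBasis ι ℂ H) (A : H →L[ℂ] H) :
    (tr e (CFC.abs A ^ 2)).re = ∑' i, ‖A (e i)‖ ^ 2 := by
  rw [tr, CFC.abs_sq, star_eq_adjoint, ← Complex.ofReal_re (∑' i, ‖A (e i)‖ ^ 2),
    Complex.ofReal_tsum]
  congr 1
  refine tsum_congr fun i => ?_
  rw [mul_apply_eq_comp, adjoint_inner_right, inner_self_eq_norm_sq_to_K]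
  simp

lemma summable_mul_pow_of_ofReal_lt {R : ℝ≥0∞} {s : ℝ} (hs0 : 0 ≤ s)
    (hs : ENNReal.ofReal s < R)
    (hf : ∀ z : ℂ, ENNReal.ofReal ‖z‖ < R → Summable fun j => (p j : ℂ) * z ^ j) :
    Summable fun j => p j * s ^ j := by
  have h := hf s (by rwa [Complex.norm_of_nonneg hs0])
  exact_mod_cast h

end PowerSeries

end TraceIneq

open TraceIneq in
theorem theorem3p2 {H : Type*} [NormedAddCommGroup H] [InnerProductSpace ℂ H] [CompleteSpace H]
    {ι : Type*} (e : HilbertBasis ι ℂ H)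
    (p q : ℕ → ℝ) (hp : ∀ j, 0 ≤ p j) (hq : ∀ j, 0 ≤ q j)
    (R : ENNReal) (hR : 0 < R)
    (hf : ∀ z : ℂ, ENNReal.ofReal ‖z‖ < R → Summable fun j => (p j : ℂ) * z ^ j)
    (hg : ∀ z : ℂ, ENNReal.ofReal ‖z‖ < R → Summable fun j => (q j : ℂ) * z ^ j)
    (T V : H →L[ℂ] H)
    (hT : TraceIneq.IsHilbertSchmidt e T) (hV : TraceIneq.IsHilbertSchmidt e V)
    (hTn : IsStarNormal T) (hVn : IsStarNormal V) (hTV : Commute T V)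
    (hTR : ENNReal.ofReal (TraceIneq.tr e (CFC.abs T ^ 2)).re < R)
    (hVR : ENNReal.ofReal (TraceIneq.tr e (CFC.abs V ^ 2)).re < R)
    -- if `H` is infinite-dimensional, a nonzero constant term would make the traces infinite
    (h0 : FiniteDimensional ℂ H ∨ (p 0 = 0 ∧ q 0 = 0)) :
    -- all operators below are given by norm convergent series and are trace class
    (∀ c ∈ ({p, q} : Set (ℕ → ℝ)),
      ∀ A ∈ ({CFC.abs T ^ 2, CFC.abs V ^ 2, ContinuousLinearMap.adjoint T * V} :
        Set (H →L[ℂ] H)),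
        Summable (TraceIneq.seriesTerm c A) ∧
          TraceIneq.IsTraceClass e (TraceIneq.applySeries c A)) ∧
    -- the traces under the square roots are nonnegative real numbers
    (∀ c ∈ ({p, q} : Set (ℕ → ℝ)),
      ∀ A ∈ ({CFC.abs T ^ 2, CFC.abs V ^ 2} : Set (H →L[ℂ] H)),
        0 ≤ (TraceIneq.tr e (TraceIneq.applySeries c A)).re ∧
          (TraceIneq.tr e (TraceIneq.applySeries c A)).im = 0) ∧
    -- superadditivity
    (√(TraceIneq.tr e (TraceIneq.applySeries p (CFC.abs T ^ 2)
            + TraceIneq.applySeries q (CFC.abs T ^ 2))).re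
          * √(TraceIneq.tr e (TraceIneq.applySeries p (CFC.abs V ^ 2)
            + TraceIneq.applySeries q (CFC.abs V ^ 2))).re
        - ‖TraceIneq.tr e (TraceIneq.applySeries p (ContinuousLinearMap.adjoint T * V)
            + TraceIneq.applySeries q (ContinuousLinearMap.adjoint T * V))‖
      ≥ (√(TraceIneq.tr e (TraceIneq.applySeries p (CFC.abs T ^ 2))).re
            * √(TraceIneq.tr e (TraceIneq.applySeries p (CFC.abs V ^ 2))).re
          - ‖TraceIneq.tr e (TraceIneq.applySeries p (ContinuousLinearMap.adjoint T * V))‖)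
        + (√(TraceIneq.tr e (TraceIneq.applySeries q (CFC.abs T ^ 2))).re
            * √(TraceIneq.tr e (TraceIneq.applySeries q (CFC.abs V ^ 2))).re
          - ‖TraceIneq.tr e (TraceIneq.applySeries q (ContinuousLinearMap.adjoint T * V))‖)) ∧
    ((√(TraceIneq.tr e (TraceIneq.applySeries p (CFC.abs T ^ 2))).re
            * √(TraceIneq.tr e (TraceIneq.applySeries p (CFC.abs V ^ 2))).re
          - ‖TraceIneq.tr e (TraceIneq.applySeries p (ContinuousLinearMap.adjoint T * V))‖)
        + (√(TraceIneq.tr e (TraceIneq.applySeries q (CFC.abs T ^ 2))).re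
            * √(TraceIneq.tr e (TraceIneq.applySeries q (CFC.abs V ^ 2))).re
          - ‖TraceIneq.tr e (TraceIneq.applySeries q (ContinuousLinearMap.adjoint T * V))‖)
      ≥ 0) ∧
    -- monotonicity
    ((∀ j, q j ≤ p j) →
      (√(TraceIneq.tr e (TraceIneq.applySeries p (CFC.abs T ^ 2))).re
            * √(TraceIneq.tr e (TraceIneq.applySeries p (CFC.abs V ^ 2))).re
          - ‖TraceIneq.tr e (TraceIneq.applySeries p (ContinuousLinearMap.adjoint T * V))‖
        ≥ √(TraceIneq.tr e (TraceIneq.applySeries q (CFC.abs T ^ 2))).re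
            * √(TraceIneq.tr e (TraceIneq.applySeries q (CFC.abs V ^ 2))).re
          - ‖TraceIneq.tr e (TraceIneq.applySeries q (ContinuousLinearMap.adjoint T * V))‖) ∧
      (√(TraceIneq.tr e (TraceIneq.applySeries q (CFC.abs T ^ 2))).re
            * √(TraceIneq.tr e (TraceIneq.applySeries q (CFC.abs V ^ 2))).re
          - ‖TraceIneq.tr e (TraceIneq.applySeries q (ContinuousLinearMap.adjoint T * V))‖
        ≥ 0)) := by
  have hT0 : 0 ≤ ∑' i, ‖T (e i)‖ ^ 2 := tsum_nonneg fun i => by positivity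
  have hV0 : 0 ≤ ∑' i, ‖V (e i)‖ ^ 2 := tsum_nonneg fun i => by positivity
  rw [tr_abs_sq] at hTR
  rw [tr_abs_sq] at hVR
  have hι : Finite ι ∨ (p 0 = 0 ∧ q 0 = 0) :=
    h0.imp_left fun h => finite_of_finiteDimensional h e
  -- Fuglede's theorem.
  have cTV : Commute (ContinuousLinearMap.adjoint T) V := hTn.commute_star_left hTV
  have cTT : Commute (ContinuousLinearMap.adjoint T) T := hTn.star_comm_self
  have cVV : Commute (ContinuousLinearMap.adjoint V) V := hVn.star_comm_self
  have pT := summable_mul_pow_of_ofReal_lt hT0 hTR hf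
  have pV := summable_mul_pow_of_ofReal_lt hV0 hVR hf
  have qT := summable_mul_pow_of_ofReal_lt hT0 hTR hg
  have qV := summable_mul_pow_of_ofReal_lt hV0 hVR hg
  have EpT := summable_energyTerm hp hT pT (hι.imp_right And.left)
  have EpV := summable_energyTerm hp hV pV (hι.imp_right And.left)
  have EqT := summable_energyTerm hq hT qT (hι.imp_right And.right)
  have EqV := summable_energyTerm hq hV qV (hι.imp_right And.right)
  have nT := norm_sq_le_tsum hT
  have nV := norm_sq_le_tsum hV
  have SpTT := summable_seriesTerm hp nT nT pT pT
  have SpVV := summable_seriesTerm hp nV nV pV pV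
  have SpTV := summable_seriesTerm hp nT nV pT pV
  have SqTT := summable_seriesTerm hq nT nT qT qT
  have SqVV := summable_seriesTerm hq nV nV qV qV
  have SqTV := summable_seriesTerm hq nT nV qT qV
  have tpTT := hasSum_tr_applySeries hp cTT SpTT EpT EpT
  have tpVV := hasSum_tr_applySeries hp cVV SpVV EpV EpV
  have tpTV := hasSum_tr_applySeries hp cTV SpTV EpT EpV
  have tqTT := hasSum_tr_applySeries hq cTT SqTT EqT EqT
  have tqVV := hasSum_tr_applySeries hq cVV SqVV EqV EqV
  have tqTV := hasSum_tr_applySeries hq cTV SqTV EqT EqV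
  rw [pairing_self] at tpTT tpVV tqTT tqVV
  have tr_add {X Y : H →L[ℂ] H} {x y : ℂ} (hX : HasSum (fun i => inner ℂ (e i) (X (e i))) x)
      (hY : HasSum (fun i => inner ℂ (e i) (Y (e i))) y) : tr e (X + Y) = x + y := by
    rw [← (hX.add hY).tsum_eq, tr]
    exact tsum_congr fun i => by simp
  have hdp := norm_pairing_le hp EpT EpV
  have hdq := norm_pairing_le hq EqT EqV
  simp only [CFC.abs_sq, ContinuousLinearMap.star_eq_adjoint, tr_add tpTT tqTT,
    tr_add tpVV tqVV, tr_add tpTV tqTV]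
  rw [show tr e (applySeries p (ContinuousLinearMap.adjoint T * V)) = _ from tpTV.tsum_eq,
    show tr e (applySeries q (ContinuousLinearMap.adjoint T * V)) = _ from tqTV.tsum_eq,
    show tr e (applySeries p (ContinuousLinearMap.adjoint T * T)) = _ from tpTT.tsum_eq,
    show tr e (applySeries q (ContinuousLinearMap.adjoint T * T)) = _ from tqTT.tsum_eq,
    show tr e (applySeries p (ContinuousLinearMap.adjoint V * V)) = _ from tpVV.tsum_eq,
    show tr e (applySeries q (ContinuousLinearMap.adjoint V * V)) = _ from tqVV.tsum_eq]
  simp only [Complex.ofReal_re, Complex.add_re]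
  refine ⟨?_, ?_, defect_add_le hp hq, by linarith, fun hqp =>
    ⟨defect_mono hq hqp EpT EpV EqT EqV, by linarith⟩⟩
  · rintro c (rfl | rfl) X (rfl | rfl | rfl)
    · exact ⟨SpTT, isTraceClass_applySeries hp cTT SpTT EpT EpT⟩
    · exact ⟨SpVV, isTraceClass_applySeries hp cVV SpVV EpV EpV⟩
    · exact ⟨SpTV, isTraceClass_applySeries hp cTV SpTV EpT EpV⟩
    · exact ⟨SqTT, isTraceClass_applySeries hq cTT SqTT EqT EqT⟩
    · exact ⟨SqVV, isTraceClass_applySeries hq cVV SqVV EqV EqV⟩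
    · exact ⟨SqTV, isTraceClass_applySeries hq cTV SqTV EqT EqV⟩
  · rintro c (rfl | rfl) X (rfl | rfl)
    · rw [show tr e (applySeries _ _) = _ from tpTT.tsum_eq]
      exact ⟨energy_nonneg hp, Complex.ofReal_im _⟩
    · rw [show tr e (applySeries _ _) = _ from tpVV.tsum_eq]
      exact ⟨energy_nonneg hp, Complex.ofReal_im _⟩
    · rw [show tr e (applySeries _ _) = _ from tqTT.tsum_eq]
      exact ⟨energy_nonneg hq, Complex.ofReal_im _⟩
    · rw [show tr e (applySeries _ _) = _ from tqVV.tsum_eq]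
      exact ⟨energy_nonneg hq, Complex.ofReal_im _⟩
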